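/- Let $p$ be an odd prime, let $F$ be a field of characteristic $p$, and let $L=\bigoplus_{i\ge 1}L_i$ be an infinite-dimensional graded Lie algebra of maximal class over $F$; that is, $\dim L_1=2$, $\dim L_i\le 1$ for $i\ge 2$, and $L$ is generated by $L_1$. For $i\ge 2$ let $C_i=\{u\in L_1 : [L_i,u]=0\}$ be the two-step centralizers. If $C_n$ is the first of them different from $C_2$, then $C_n$ is called the second two-step centralizer and $C_2,\dots,C_n$ is called the first constituent, regarded as having length $n$. The further constituents are the segments $C_{i+1},\dots,C_{i+l}$ with $i\ge 2$, $l\ge 1$, $C_i\ne C_2$, $C_{i+l}\ne C_2$ and $C_j=C_2$ for $i<j<i+l$; such a constituent has length $l$. Suppose that the sequence of constituent lengths of $L$ begins $$2q,\ \underbrace{q,\dots,q}_{m},\ 2q-p^{\beta},$$ where $q\ge 1$, $m\ge 0$, $\beta\ge 0$ are integers with $p^{\beta}<q$, and that no two-step centralizer other than the first two, $C_2$ and $C_{2q}$, occurs before the constituent of length $2q-p^\beta$; that is, $C_i\in\{C_2,C_{2q}\}$ for $2\le i\le 2q+mq$. Then $m=p^{k}-2$ for some integer $k\ge 0$. -/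

import Mathlib

namespace MaximalClass

section

variable {F L : Type*} [Field F] [LieRing L] [LieAlgebra F L]

/-- The graded Lie algebra `L = ⨁_{i ≥ 1} L_i` (with `L_0 = 0`) is a graded Lie algebra of maximal class:
`dim L_1 = 2`, `dim L_i ≤ 1` for `i ≥ 2`, and `L` is generated by `L_1`. -/
structure IsMaximalClass (𝓛 : ℕ → Submodule F L) [GradedLieAlgebra 𝓛] : Prop where
  zero_eq_bot : 𝓛 0 = ⊥
  rank_one : Module.rank F (𝓛 1) = 2
  rank_le_one : ∀ i : ℕ, 2 ≤ i → Module.rank F (𝓛 i) ≤ 1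
  generated : LieSubalgebra.lieSpan F L (𝓛 1 : Set L) = ⊤

/-- The two-step centralizer `C_i = C_{L_1}(L_i)`. -/
def twoStepCentralizer (𝓛 : ℕ → Submodule F L) (i : ℕ) : Submodule F L where
  carrier := {u | u ∈ 𝓛 1 ∧ ∀ v ∈ 𝓛 i, ⁅v, u⁆ = 0}
  add_mem' := by
    rintro a b ⟨ha, ha'⟩ ⟨hb, hb'⟩
    exact ⟨add_mem ha hb, fun v hv => by rw [lie_add, ha' v hv, hb' v hv, add_zero]⟩
  zero_mem' := ⟨zero_mem _, fun v _ => lie_zero v⟩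
  smul_mem' := by
    rintro c a ⟨ha, ha'⟩
    exact ⟨Submodule.smul_mem _ c ha, fun v hv => by rw [lie_smul, ha' v hv, smul_zero]⟩

/-- `C_2, …, C_n` is the first constituent (by convention, of length `n`): `C_n` is the first
two-step centralizer different from `C_2`. Thus `C_n` is the second two-step centralizer in
order of occurrence. -/
def IsFirstConstituent (𝓛 : ℕ → Submodule F L) (n : ℕ) : Prop :=
  2 < n ∧ twoStepCentralizer 𝓛 n ≠ twoStepCentralizer 𝓛 2 ∧
    ∀ j : ℕ, 2 ≤ j → j < n → twoStepCentralizer 𝓛 j = twoStepCentralizer 𝓛 2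

/-- `C_{i+1}, …, C_{i+l}` is a constituent of length `l`, other than the first one. -/
def IsConstituent (𝓛 : ℕ → Submodule F L) (i l : ℕ) : Prop :=
  2 ≤ i ∧ 0 < l ∧ twoStepCentralizer 𝓛 i ≠ twoStepCentralizer 𝓛 2 ∧
    twoStepCentralizer 𝓛 (i + l) ≠ twoStepCentralizer 𝓛 2 ∧
    ∀ j : ℕ, i < j → j < i + l → twoStepCentralizer 𝓛 j = twoStepCentralizer 𝓛 2

/-- Starting right after `C_i`, there are consecutive constituents with the listed lengths. -/
def ConsecutiveConstituents (𝓛 : ℕ → Submodule F L) : ℕ → List ℕ → Prop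
  | _, [] => True
  | i, l :: ls => IsConstituent 𝓛 i l ∧ ConsecutiveConstituents 𝓛 (i + l) ls

/-- The sequence of constituent lengths begins with the given list. -/
def ConstituentLengthsBegin (𝓛 : ℕ → Submodule F L) : List ℕ → Prop
  | [] => True
  | n :: ls => IsFirstConstituent 𝓛 n ∧ ConsecutiveConstituents 𝓛 n ls

end

end MaximalClass

/-! Let `y` and `x` span the first and second two-step centralizers and put z = x + y, with the sign
of `y` chosen suitably. In the basis v_1 = y, v_{i+1} = [v_i, z], the algebra is encoded up to a
given degree by scalars with [v_i, y] = β_i v_{i+1}: β_i is 0 or 1 exactly when C_i is the first or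
second centralizer. The brackets [v_i, v_j] are alternating binomial sums of the β (`lie_ladder`),
so anticommutativity and Jacobi become binomial identities in `F`.

Put r = m + 2 and d = q - p^β. The second centralizer occurs in degrees 2q, 3q, …, rq, and the next
constituent ends in degree N = (r + 1)q + d. Anticommutativity in low degrees makes q a power of p
(`HasCoeffSequences.eq_prime_pow`). Lucas' theorem then splits each binomial into a factor for
multiples of q and a factor for residues, the latter vanishing or a sign, so only binomials of size
about r remain.

Write r = p^n u with p ∤ u and suppose u > 1. Then the sequence is forced beyond N: C_N is the
second centralizer (`second_at_intermediate_end`), and so is the centralizer in degree N + eq for 1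
≤ e ≤ p^n (`second_of_lt`), with only the first in between (`gap`). Anticommutativity of v_1 with
the element of degree N + p^n q now requires (r + p^n choose r) = 1 in `F` (`cast_choose_eq_one`).
By Lucas this binomial is u + 1, so p divides u, a contradiction. -/

namespace MaximalClass

open Finset

/-! ### Binomial coefficients modulo p -/

section Binomial

variable {F : Type*} [Field F] {p : ℕ}

theorem two_ne_zero_of_odd_prime [CharP F p] (hp : p.Prime) (hodd : Odd p) : (2 : F) ≠ 0 := by
  have : ((2 : ℕ) : F) ≠ 0 := by
    rw [Ne, CharP.cast_eq_zero_iff F p]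
    intro h
    rw [(Nat.prime_dvd_prime_iff_eq hp Nat.prime_two).1 h] at hodd
    exact absurd hodd (by decide)
  simpa using this

theorem choose_modEq_choose_mod_pow_mul_choose_div_pow (hp : p.Prime) (h n k : ℕ) :
    n.choose k ≡ (n % p ^ h).choose (k % p ^ h) * (n / p ^ h).choose (k / p ^ h) [MOD p] := by
  have : Fact p.Prime := ⟨hp⟩
  induction h generalizing n k with
  | zero => simp [Nat.mod_one, Nat.ModEq]
  | succ h ih =>
    have h1 := Choose.choose_modEq_choose_mod_mul_choose_div_nat (p := p) (n := n) (k := k)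
    have h2 := Choose.choose_modEq_choose_mod_mul_choose_div_nat (p := p)
      (n := n % p ^ (h + 1)) (k := k % p ^ (h + 1))
    have e : ∀ a : ℕ, a % p ^ (h + 1) % p = a % p := fun a =>
      Nat.mod_mod_of_dvd a (dvd_pow_self p (Nat.succ_ne_zero h))
    have e' : ∀ a : ℕ, a % p ^ (h + 1) / p = a / p % p ^ h := fun a => by
      rw [pow_succ', Nat.mod_mul_right_div_self]
    have e'' : ∀ a : ℕ, a / p ^ (h + 1) = a / p / p ^ h := fun a => by
      rw [pow_succ', Nat.div_div_eq_div_mul]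
    rw [e, e, e', e'] at h2
    rw [e'', e'']
    refine h1.trans ((Nat.ModEq.mul_left _ (ih (n / p) (k / p))).trans ?_)
    rw [← mul_assoc]
    exact Nat.ModEq.mul_right _ h2.symm

/-- Lucas' theorem with the base-p digits cut at place `h`. It is used mostly in two ways: the
residue factor is 0 when e > b, and a sign when b = q - 1. -/
theorem cast_choose_add_mul_pow [CharP F p] (hp : p.Prime) {h q : ℕ} (hq : q = p ^ h)
    (a c : ℕ) {b e : ℕ} (hb : b < q) (he : e < q) :
    ((a * q + b).choose (c * q + e) : F) = (a.choose c : F) * (b.choose e : F) := by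
  have hq0 : 0 < q := by omega
  have key := choose_modEq_choose_mod_pow_mul_choose_div_pow hp h (a * q + b) (c * q + e)
  rw [← hq] at key
  have e1 : ∀ a b : ℕ, b < q → (a * q + b) % q = b := fun a b hb => by
    rw [mul_comm, Nat.mul_add_mod, Nat.mod_eq_of_lt hb]
  have e2 : ∀ a b : ℕ, b < q → (a * q + b) / q = a := fun a b hb => by
    rw [mul_comm, Nat.mul_add_div hq0, Nat.div_eq_of_lt hb, add_zero]
  rw [e1 _ _ hb, e1 _ _ he, e2 _ _ hb, e2 _ _ he, mul_comm (b.choose e)] at key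
  have := (CharP.natCast_eq_natCast F p).2 key
  rwa [Nat.cast_mul] at this

theorem cast_choose_pow_sub_one [CharP F p] (hp : p.Prime) {h q : ℕ} (hq : q = p ^ h)
    {k : ℕ} (hk : k < q) : ((q - 1).choose k : F) = (-1) ^ k := by
  induction k with
  | zero => simp
  | succ k ih =>
    have h1 : ((q.choose (k + 1) : ℕ) : F) = 0 := by
      rw [CharP.cast_eq_zero_iff F p, hq]
      exact hp.dvd_choose_pow (by omega) (by omega)
    obtain ⟨q', rfl⟩ : ∃ q', q = q' + 1 := ⟨q - 1, by omega⟩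
    rw [Nat.choose_succ_succ, Nat.cast_add] at h1
    have := ih (by omega)
    simp only [Nat.add_sub_cancel] at this ⊢
    rw [this] at h1
    rw [pow_succ]
    linear_combination h1

theorem alternating_sum_choose_range (n m : ℕ) :
    ∑ k ∈ range (m + 1), (-1 : F) ^ k * ((n + 1).choose k : F) = (-1) ^ m * (n.choose m : F) := by
  have := congrArg (Int.cast : ℤ → F) (Int.alternating_sum_range_choose_eq_choose (n := n) (m := m))
  push_cast at this
  exact this

theorem alternating_sum_choose_eq_zero {n : ℕ} (hn : n ≠ 0) :
    ∑ k ∈ range (n + 1), (-1 : F) ^ k * (n.choose k : F) = 0 := by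
  have := congrArg (Int.cast : ℤ → F) (Int.alternating_sum_range_choose_of_ne hn)
  push_cast at this
  exact this

end Binomial

/-! ### Structure constants in terms of β -/

section BracketCoeff

variable {F : Type*} [Field F]

/-- If `[v_i, z] = v_{i+1}` and `[v_i, y] = β_i v_{i+1}` for all `i ≥ 1`, where `v_1 = y`, then
`[v_i, v_j] = bracketCoeff β i j • v_{i+j}` for `i, j ≥ 1`. -/
def bracketCoeff (β : ℕ → F) (i j : ℕ) : F :=
  ∑ k ∈ range j, (-1) ^ k * ((j - 1).choose k : F) * β (i + k)

@[simp]
theorem bracketCoeff_one (β : ℕ → F) (i : ℕ) : bracketCoeff β i 1 = β i := by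
  simp [bracketCoeff]

theorem bracketCoeff_succ (β : ℕ → F) (i : ℕ) {j : ℕ} (hj : 1 ≤ j) :
    bracketCoeff β i (j + 1) = bracketCoeff β i j - bracketCoeff β (i + 1) j := by
  obtain ⟨n, rfl⟩ : ∃ n, j = n + 1 := ⟨j - 1, by omega⟩
  have h1 : bracketCoeff β i (n + 1)
      = ∑ k ∈ range (n + 2), (-1) ^ k * (n.choose k : F) * β (i + k) := by
    rw [sum_range_succ]
    simp [bracketCoeff]
  rw [h1]
  unfold bracketCoeff
  rw [sum_range_succ', sum_range_succ' _ (n + 1)]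
  simp only [Nat.add_sub_cancel, Nat.choose_succ_succ, Nat.cast_add]
  have h2 : ∀ k, β (i + 1 + k) = β (i + (k + 1)) := fun k => by rw [add_right_comm, add_assoc]
  simp only [h2, pow_succ]
  simp only [Nat.choose_zero_right, pow_zero, Nat.cast_one]
  rw [add_sub_right_comm, ← sum_sub_distrib]
  congr 1
  exact sum_congr rfl fun k _ => by ring

theorem bracketCoeff_eq_sum_of_support (β : ℕ → F) {i j : ℕ} (S : Finset ℕ)
    (hS : ∀ a ∈ S, i ≤ a) (h : ∀ l, i ≤ l → l < i + j → l ∉ S → β l = 0) (hj : 1 ≤ j) :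
    bracketCoeff β i j = ∑ a ∈ S, (-1) ^ (a - i) * ((j - 1).choose (a - i) : F) * β a := by
  have h1 : bracketCoeff β i j
      = ∑ l ∈ Ico i (i + j), (-1) ^ (l - i) * ((j - 1).choose (l - i) : F) * β l := by
    rw [sum_Ico_eq_sum_range]
    simp [bracketCoeff]
  have h2 : ∑ a ∈ S, (-1) ^ (a - i) * ((j - 1).choose (a - i) : F) * β a
      = ∑ a ∈ S ∩ Ico i (i + j), (-1) ^ (a - i) * ((j - 1).choose (a - i) : F) * β a := by
    refine (sum_subset inter_subset_left fun a ha ha' => ?_).symm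
    have : i + j ≤ a := by
      by_contra hlt
      exact ha' (mem_inter.2 ⟨ha, mem_Ico.2 ⟨hS a ha, by omega⟩⟩)
    rw [Nat.choose_eq_zero_of_lt (by omega)]
    simp
  rw [h1, h2]
  refine (sum_subset inter_subset_right fun a ha ha' => ?_).symm
  obtain ⟨h3, h4⟩ := mem_Ico.1 ha
  rw [h a h3 h4 fun hS => ha' (mem_inter.2 ⟨hS, ha⟩), mul_zero]

theorem bracketCoeff_eq_single (β : ℕ → F) {i j a : ℕ} (ha : i ≤ a)
    (h : ∀ l, i ≤ l → l < i + j → l ≠ a → β l = 0) (hj : 1 ≤ j) :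
    bracketCoeff β i j = (-1) ^ (a - i) * ((j - 1).choose (a - i) : F) * β a := by
  rw [bracketCoeff_eq_sum_of_support β {a} (by simpa using ha) (by simpa using h) hj, sum_singleton]

/-- The nonzero β will lie on two progressions of difference q, the ends up to rq and those from N
on; `hab` makes them disjoint. Terms beyond the range of summation do no harm, since their binomials
vanish. -/
theorem bracketCoeff_eq_progressions (β : ℕ → F) {i j a b q n n' : ℕ} (hq : 0 < q) (hia : i ≤ a)
    (hab : a + n * q ≤ b) (hj : 1 ≤ j)
    (h : ∀ l, i ≤ l → l < i + j → (∀ t < n, l ≠ a + t * q) → (∀ f < n', l ≠ b + f * q) → β l = 0) :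
    bracketCoeff β i j =
      (∑ t ∈ range n, (-1) ^ (a + t * q - i) * ((j - 1).choose (a + t * q - i) : F)
        * β (a + t * q)) +
      ∑ f ∈ range n', (-1) ^ (b + f * q - i) * ((j - 1).choose (b + f * q - i) : F)
        * β (b + f * q) := by
  have inj : ∀ c : ℕ, Function.Injective fun t => c + t * q := fun c s t hst => by
    have : s * q = t * q := by simpa using hst
    exact Nat.eq_of_mul_eq_mul_right hq this
  rw [bracketCoeff_eq_sum_of_support β
    ((range n).image (fun t => a + t * q) ∪ (range n').image (fun f => b + f * q)) _ _ hj,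
    sum_union, sum_image ((inj a).injOn), sum_image ((inj b).injOn)]
  · rw [disjoint_left]
    intro l hl hl'
    obtain ⟨t, ht, rfl⟩ := mem_image.1 hl
    obtain ⟨f, hf, hft⟩ := mem_image.1 hl'
    have : (t + 1) * q ≤ n * q := Nat.mul_le_mul_right q (mem_range.1 ht)
    rw [add_mul, one_mul] at this
    omega
  · intro l hl
    rcases mem_union.1 hl with hl | hl <;> obtain ⟨t, ht, rfl⟩ := mem_image.1 hl
    all_goals omega
  · intro l h1 h2 hl
    refine h l h1 h2 (fun t ht hlt => hl ?_) fun t ht hlt => hl ?_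
    · exact mem_union_left _ (mem_image.2 ⟨t, mem_range.2 ht, hlt.symm⟩)
    · exact mem_union_right _ (mem_image.2 ⟨t, mem_range.2 ht, hlt.symm⟩)

/-- The identities in degrees up to `W + 1` satisfied by the structure constants of a graded Lie
algebra of maximal class with respect to the basis `v_1, v_2, …`: anticommutativity, and the
Jacobi identity on the triples `v_i, v_j, y`. -/
structure BracketIdentities (β : ℕ → F) (W : ℕ) : Prop where
  antisymm : ∀ i j : ℕ, 1 ≤ i → 1 ≤ j → i + j ≤ W + 1 →
    bracketCoeff β i j = -bracketCoeff β j i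
  jacobi : ∀ i j : ℕ, 1 ≤ i → 1 ≤ j → i + j ≤ W →
    bracketCoeff β i j * β (i + j) =
      β i * bracketCoeff β (i + 1) j + β j * bracketCoeff β i (j + 1)

end BracketCoeff

/-! ### Forcing the pattern of centralizers -/

section Pattern

variable {F : Type*} [Field F] {p : ℕ}

/-- `β` records the action of `y` up to degree `W`, where `P i` and `Q i` mean that the `i`-th
two-step centralizer is the first, respectively the second one in order of occurrence. -/
structure IsCoeffSequence (P Q : ℕ → Prop) (W : ℕ) (β : ℕ → F) : Prop where
  one : β 1 = 0
  eq_zero_iff : ∀ i, 2 ≤ i → i ≤ W → (β i = 0 ↔ P i)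
  eq_one_iff : ∀ i, 2 ≤ i → i ≤ W → (β i = 1 ↔ Q i)
  identities : BracketIdentities β W
  next : ∀ i j, 1 ≤ i → 1 ≤ j → i + j = W + 1 → β i = 0 → β j = 0 →
    bracketCoeff β i j ≠ 0 → P (W + 1)

variable (F) in
/-- There is a coefficient sequence up to degree `W` whenever at most one two-step centralizer
among the first `W` differs from the first two. -/
def HasCoeffSequences (P Q : ℕ → Prop) : Prop :=
  ∀ n W : ℕ, (∀ i, 2 ≤ i → i ≤ W → i ≠ n → P i ∨ Q i) → ∃ β : ℕ → F, IsCoeffSequence P Q W β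

theorem mul_add_ne_mul {a b d q : ℕ} (hd : 0 < d) (hdq : d < q) : a * q + d ≠ b * q := by
  intro h
  have := congrArg (· % q) h
  simp only [Nat.mul_mod_left] at this
  rw [mul_comm, Nat.mul_add_mod, Nat.mod_eq_of_lt hdq] at this
  omega

theorem neg_one_pow_mul_add {q d : ℕ} (hq : Odd q) (hd : Even d) (a : ℕ) :
    (-1 : F) ^ (a * q + d) = (-1) ^ a := by
  rw [pow_add, hd.neg_one_pow, mul_one, mul_comm, pow_mul, hq.neg_one_pow]

theorem neg_one_pow_mul_add_sub_one {q d : ℕ} (hq : Odd q) (hd : Even d) (hd0 : 0 < d) (a : ℕ) :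
    (-1 : F) ^ (a * q + (d - 1)) = -(-1) ^ a := by
  have := neg_one_pow_mul_add (F := F) hq hd a
  rw [show a * q + d = a * q + (d - 1) + 1 by omega, pow_succ] at this
  linear_combination -this

/-- If q = p^k u with p ∤ u and u > 1, then j = p^k is admissible and (2q choose p^k) ≡ 2u, which is
nonzero mod p. -/
theorem eq_prime_pow_of_cast_choose_two_mul [CharP F p] (hp : p.Prime) (hodd : Odd p) {q : ℕ}
    (hq : 0 < q) (h : ∀ j, 1 ≤ j → j < q → ((2 * q).choose j : F) = 0) : ∃ k, q = p ^ k := by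
  obtain ⟨k, u, hu, hqu⟩ := Nat.exists_eq_pow_mul_and_not_dvd hq.ne' p hp.ne_one
  refine ⟨k, ?_⟩
  by_contra hne
  have hpk : 0 < p ^ k := pow_pos hp.pos k
  have hle : p ^ k < q := by
    refine lt_of_le_of_ne (Nat.le_of_dvd hq ⟨u, hqu⟩) (Ne.symm hne)
  have h1 := h (p ^ k) hpk hle
  rw [CharP.cast_eq_zero_iff F p] at h1
  have : Fact p.Prime := ⟨hp⟩
  have h2 := Choose.choose_pow_mul_pow_mul_modEq_choose_nat (p := p) (k := k)
    (a := 2 * u) (b := 1)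
  rw [show p ^ k * (2 * u) = 2 * q by rw [hqu]; ring, mul_one, Nat.choose_one_right] at h2
  have h3 : p ∣ 2 * u := (Nat.modEq_zero_iff_dvd.1 (h2.symm.trans (Nat.modEq_zero_iff_dvd.2 h1)))
  rcases hp.dvd_mul.1 h3 with h4 | h4
  · have := (Nat.prime_dvd_prime_iff_eq hp Nat.prime_two).1 h4
    subst this
    exact absurd hodd (by decide)
  · exact hu h4

variable {P Q : ℕ → Prop}

/-- Below degree 3q only β_{2q} is nonzero, so anticommutativity of v_{2q} and v_{j+1} compares two
single terms and gives (2q - 1 choose j) = (-1)^j for j < q. Adjacent values cancel in Pascal's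
rule. -/
theorem HasCoeffSequences.eq_prime_pow [CharP F p] (hp : p.Prime) (hodd : Odd p)
    (H : HasCoeffSequences F P Q) {q : ℕ} (hq : 2 ≤ q)
    (hP : ∀ i, 2 ≤ i → i < 3 * q → i ≠ 2 * q → P i) (hQ : Q (2 * q)) : ∃ k, q = p ^ k := by
  obtain ⟨β, hβ⟩ := H 0 (3 * q - 1) fun i h1 h2 _ => by
    by_cases hi : i = 2 * q
    · exact Or.inr (hi ▸ hQ)
    · exact Or.inl (hP i h1 (by omega) hi)
  have h0 : ∀ l, 1 ≤ l → l < 3 * q → l ≠ 2 * q → β l = 0 := fun l h1 h2 h3 => by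
    rcases Nat.lt_or_ge l 2 with h4 | h4
    · rw [show l = 1 by omega]; exact hβ.one
    · exact (hβ.eq_zero_iff l h4 (by omega)).2 (hP l h4 h2 h3)
  have h1 : β (2 * q) = 1 := (hβ.eq_one_iff _ (by omega) (by omega)).2 hQ
  have key : ∀ j, j < q → ((2 * q - 1).choose j : F) = (-1) ^ j := fun j hj => by
    have h2 := hβ.identities.antisymm (2 * q) (j + 1) (by omega) (by omega) (by omega)
    rw [bracketCoeff_eq_single β le_rfl (fun l h3 h4 h5 => h0 l (by omega) (by omega) h5)
      (by omega), bracketCoeff_eq_single (a := 2 * q) β (by omega)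
      (fun l h3 h4 h5 => h0 l (by omega) (by omega) h5) (by omega), h1] at h2
    rw [← Nat.choose_symm (n := 2 * q - 1) (k := j) (by omega),
      show 2 * q - 1 - j = 2 * q - (j + 1) by omega]
    have h6 : (-1 : F) ^ (2 * q - (j + 1)) * (-1) ^ j = -1 := by
      rw [← pow_add, show 2 * q - (j + 1) + j = 2 * (q - 1) + 1 by omega, pow_succ, pow_mul]
      simp
    simp only [Nat.sub_self, pow_zero, Nat.choose_zero_right, Nat.cast_one, mul_one] at h2
    linear_combination -(-1 : F) ^ j * h2 +
      ((2 * q - 1).choose (2 * q - (j + 1)) : F) * h6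
  refine eq_prime_pow_of_cast_choose_two_mul (F := F) hp hodd (by omega) fun j hj hjq => ?_
  obtain ⟨j, rfl⟩ : ∃ i, j = i + 1 := ⟨j - 1, by omega⟩
  rw [show 2 * q = (2 * q - 1) + 1 by omega, Nat.choose_succ_succ, Nat.cast_add,
    key j (by omega), key (j + 1) hjq, pow_succ]
  ring

/-- Since `y` kills both v_{W+1-q} and v_q, it kills their bracket. That bracket involves β only on
the last q degrees, where β_b alone is nonzero, with coefficient ± (q - 1 choose ·) = ±1; hence it
is a nonzero multiple of v_{W+1}. -/
theorem IsCoeffSequence.next_of_gap [CharP F p] (hp : p.Prime) {h q : ℕ} (hq : q = p ^ h)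
    (hq2 : 2 ≤ q) {W b t : ℕ} {β : ℕ → F} (hβ : IsCoeffSequence P Q W β) (hPq : P q) (hb : q ≤ b)
    (ht : 0 < t) (htq : t < q) (hW : W + 1 = b + t) (hbne : β b ≠ 0)
    (h0 : ∀ l, b < l + q → l ≤ W → l ≠ b → β l = 0) : P (W + 1) := by
  refine hβ.next (W + 1 - q) q (by omega) (by omega) (by omega)
    (h0 _ (by omega) (by omega) (by omega))
    ((hβ.eq_zero_iff q hq2 (by omega)).2 hPq) ?_
  rw [bracketCoeff_eq_single (a := b) β (by omega)
    (fun l h1 h2 h3 => h0 l (by omega) (by omega) h3) (by omega),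
    cast_choose_pow_sub_one hp hq (by omega)]
  exact mul_ne_zero (mul_ne_zero (pow_ne_zero _ (by simp)) (pow_ne_zero _ (by simp))) hbne

/-- Up to degree `(r + 1 + e) * q + d`, excluded, the first two-step centralizer occurs everywhere
except that the second one occurs in degrees `2q, 3q, …, rq` and in degrees
`(r + 1 + f) * q + d` for `f < e`. -/
structure InitialPattern (P Q : ℕ → Prop) (q r d e : ℕ) : Prop where
  short : ∀ h, 2 ≤ h → h ≤ r → Q (h * q)
  later : ∀ f < e, Q ((r + 1) * q + d + f * q)
  rest : ∀ l, 2 ≤ l → l < (r + 1) * q + d + e * q → (∀ h, 2 ≤ h → h ≤ r → l ≠ h * q) →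
    (∀ f < e, l ≠ (r + 1) * q + d + f * q) → P l

namespace InitialPattern

variable {q r d e : ℕ}

theorem eq_zero (h : InitialPattern P Q q r d e) {W : ℕ} {β : ℕ → F}
    (hβ : IsCoeffSequence P Q W β) {l : ℕ} (h1 : 1 ≤ l) (hW : l ≤ W)
    (h2 : l < (r + 1) * q + d + e * q) (h3 : ∀ h, 2 ≤ h → h ≤ r → l ≠ h * q)
    (h4 : ∀ f < e, l ≠ (r + 1) * q + d + f * q) : β l = 0 := by
  rcases Nat.lt_or_ge l 2 with h5 | h5
  · rw [show l = 1 by omega]; exact hβ.one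
  · exact (hβ.eq_zero_iff l h5 hW).2 (h.rest l h5 h2 h3 h4)

theorem or_of_lt (h : InitialPattern P Q q r d e) {l : ℕ} (h1 : 2 ≤ l)
    (h2 : l < (r + 1) * q + d + e * q) : P l ∨ Q l := by
  by_cases h3 : ∃ h, 2 ≤ h ∧ h ≤ r ∧ l = h * q
  · obtain ⟨n, h4, h5, rfl⟩ := h3
    exact Or.inr (h.short n h4 h5)
  by_cases h4 : ∃ f < e, l = (r + 1) * q + d + f * q
  · obtain ⟨f, h4, rfl⟩ := h4
    exact Or.inr (h.later f h4)
  push Not at h3 h4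
  exact Or.inl (h.rest l h1 h2 h3 h4)

theorem eq_one_short (h : InitialPattern P Q q r d e) (hq : 2 ≤ q) {W : ℕ} {β : ℕ → F}
    (hβ : IsCoeffSequence P Q W β) {n : ℕ} (h1 : 2 ≤ n) (h2 : n ≤ r) (hW : r * q ≤ W) :
    β (n * q) = 1 :=
  (hβ.eq_one_iff _ (le_trans (by omega) (Nat.mul_le_mul h1 hq))
    ((Nat.mul_le_mul_right q h2).trans hW)).2 (h.short n h1 h2)

theorem eq_one_later (h : InitialPattern P Q q r d e) (hq : 2 ≤ q) {W : ℕ} {β : ℕ → F}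
    (hβ : IsCoeffSequence P Q W β) {f : ℕ} (h1 : f < e) (hW : (r + 1) * q + d + f * q ≤ W) :
    β ((r + 1) * q + d + f * q) = 1 :=
  (hβ.eq_one_iff _ (by nlinarith [Nat.zero_le (r * q), Nat.zero_le (f * q)]) hW).2 (h.later f h1)

/-- After the end of a constituent the first two-step centralizer occurs at least `q - 1` times. -/
theorem gap [CharP F p] (hp : p.Prime) {k : ℕ} (hqk : q = p ^ k) (hq : 2 ≤ q)
    (H : HasCoeffSequences F P Q) (h : InitialPattern P Q q r d e) (hd : 0 < d)
    (hr : 2 ≤ r) (hne : ¬ P ((r + 1) * q + d + e * q)) :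
    ∀ t, 0 < t → t < q → P ((r + 1) * q + d + e * q + t) := by
  intro t
  induction t using Nat.strong_induction_on with
  | _ t ih =>
  intro ht htq
  have hrq : 2 * q ≤ r * q := Nat.mul_le_mul_right q hr
  have hrq1 : (r + 1) * q = r * q + q := by ring
  set b := (r + 1) * q + d + e * q with hb
  obtain ⟨β, hβ⟩ := H b (b + t - 1) fun i h1 h2 h3 => by
    rcases lt_or_gt_of_ne h3 with h4 | h4
    · exact h.or_of_lt h1 h4
    · left
      rw [show i = b + (i - b) by omega]
      exact ih (i - b) (by omega) (by omega) (by omega)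
  have hPq : P q := by
    refine h.rest q hq (by omega) (fun n h1 _ h3 => ?_) fun f _ h3 => ?_
    · have : 2 * q ≤ n * q := Nat.mul_le_mul_right q h1
      omega
    · have := Nat.zero_le (f * q)
      omega
  have := hβ.next_of_gap (b := b) (t := t) hp hqk hq hPq (by omega) ht htq (by omega)
    (fun h0 => hne ((hβ.eq_zero_iff b (by omega) (by omega)).1 h0)) fun l h1 h2 h3 => by
      rcases lt_or_gt_of_ne h3 with h4 | h4
      · refine h.eq_zero hβ (by omega) h2 h4 (fun n _ h6 h7 => ?_) fun f h6 h7 => ?_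
        · have := Nat.mul_le_mul_right q h6
          omega
        · have : (f + 1) * q ≤ e * q := Nat.mul_le_mul_right q h6
          rw [add_mul, one_mul] at this
          omega
      · refine (hβ.eq_zero_iff l (by omega) h2).2 ?_
        rw [show l = b + (l - b) by omega]
        exact ih (l - b) (by omega) (by omega) (by omega)
  rwa [show b + t - 1 + 1 = b + t by omega] at this

theorem succ [CharP F p] (hp : p.Prime) {k : ℕ} (hqk : q = p ^ k) (hq : 2 ≤ q)
    (H : HasCoeffSequences F P Q) (h : InitialPattern P Q q r d e) (hd : 0 < d)
    (hr : 2 ≤ r) (hQ : Q ((r + 1) * q + d + e * q)) : InitialPattern P Q q r d (e + 1) := by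
  have hb : 2 ≤ (r + 1) * q + d + e * q := by nlinarith [Nat.zero_le (r * q), Nat.zero_le (e * q)]
  have hne : ¬ P ((r + 1) * q + d + e * q) := fun hP => by
    obtain ⟨β, hβ⟩ := H ((r + 1) * q + d + e * q) ((r + 1) * q + d + e * q) fun i h1 h2 h3 =>
      h.or_of_lt h1 (by omega)
    have h1 := (hβ.eq_zero_iff _ hb le_rfl).2 hP
    rw [(hβ.eq_one_iff _ hb le_rfl).2 hQ] at h1
    exact one_ne_zero h1
  refine ⟨h.short, fun f hf => ?_, fun l h1 h2 h3 h4 => ?_⟩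
  · rcases Nat.lt_succ_iff_lt_or_eq.1 hf with hf | rfl
    exacts [h.later f hf, hQ]
  · rcases lt_trichotomy l ((r + 1) * q + d + e * q) with h5 | h5 | h5
    · exact h.rest l h1 h5 h3 fun f hf => h4 f (by omega)
    · exact absurd h5 (h4 e (by omega))
    · have heq : (e + 1) * q = e * q + q := by ring
      have := h.gap hp hqk hq H hd hr hne (l - ((r + 1) * q + d + e * q)) (by omega) (by omega)
      rwa [Nat.add_sub_cancel' h5.le] at this

theorem exists_coeff (H : HasCoeffSequences F P Q) (h : InitialPattern P Q q r d e) :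
    ∃ β : ℕ → F, IsCoeffSequence P Q ((r + 1) * q + d + e * q) β :=
  H ((r + 1) * q + d + e * q) _ fun _ h1 h2 h3 => h.or_of_lt h1 (by omega)

/-- The ends in degrees hq have offset hq - 1 ≡ q - 1 mod q from v_1, and Lucas gives them the
factor (d - 1 choose q - 1) = 0. Only the ends from N on survive. -/
theorem bracketCoeff_one_left [CharP F p] (hp : p.Prime) {k : ℕ} (hqk : q = p ^ k) (hq : 2 ≤ q)
    (h : InitialPattern P Q q r d e) (hd : 0 < d) (hdq : d < q) (hr : 2 ≤ r) {β : ℕ → F}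
    (hβ : IsCoeffSequence P Q ((r + 1) * q + d + e * q) β) :
    bracketCoeff β 1 ((r + 1) * q + d + e * q) = ∑ f ∈ range (e + 1),
      (-1) ^ ((r + 1 + f) * q + (d - 1)) * ((r + 1 + e).choose (r + 1 + f) : F) *
        β ((r + 1) * q + d + f * q) := by
  have hrq : 2 * q ≤ r * q := Nat.mul_le_mul_right q hr
  have hrq1 : (r + 1) * q = r * q + q := by ring
  have hrq2 : 2 * q + (r - 1) * q = (r + 1) * q := by
    rw [← add_mul]; congr 1; omega
  rw [bracketCoeff_eq_progressions β (a := 2 * q) (n := r - 1) (b := (r + 1) * q + d)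
    (q := q) (n' := e + 1) (by omega) (by omega) (by omega) (by omega), sum_eq_zero, zero_add]
  · refine sum_congr rfl fun f hf => ?_
    rw [show (r + 1) * q + d + f * q - 1 = (r + 1 + f) * q + (d - 1) by
      rw [add_mul (r + 1)]; omega,
      show (r + 1) * q + d + e * q - 1 = (r + 1 + e) * q + (d - 1) by
      rw [add_mul (r + 1)]; omega, cast_choose_add_mul_pow hp hqk _ _ (by omega) (by omega),
      Nat.choose_self, Nat.cast_one, mul_one]
  · intro t ht
    rw [show 2 * q + t * q - 1 = (t + 1) * q + (q - 1) by
      rw [add_mul]; omega,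
      show (r + 1) * q + d + e * q - 1 = (r + 1 + e) * q + (d - 1) by
      rw [add_mul (r + 1)]; omega, cast_choose_add_mul_pow hp hqk _ _ (by omega) (by omega),
      Nat.choose_eq_zero_of_lt (n := d - 1) (by omega)]
    simp
  · intro l h1 h2 h3 h4
    have h5 := h4 e (by omega)
    refine h.eq_zero hβ h1 (by omega) (by omega) (fun n hn hnr hl => ?_) fun f hf => h4 f (by omega)
    refine h3 (n - 2) (by omega) ?_
    rw [← add_mul, hl]; congr 1; omega

/-- Anticommutativity of v_1 and v_N involves β_N alone, and reads (-1)^{r+1} β_N = β_N. -/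
theorem even_succ [CharP F p] (hp : p.Prime) {k : ℕ} (hqk : q = p ^ k) (hq : 2 ≤ q)
    (hqo : Odd q) (h2 : (2 : F) ≠ 0) (H : HasCoeffSequences F P Q)
    (h : InitialPattern P Q q r d 0) (hd : 0 < d) (hdq : d < q) (hde : Even d)
    (hr : 2 ≤ r) (hne : ¬ P ((r + 1) * q + d)) : Even (r + 1) := by
  obtain ⟨β, hβ⟩ := h.exists_coeff H
  have h1 := h.bracketCoeff_one_left hp hqk hq hd hdq hr hβ
  have hN : 2 ≤ (r + 1) * q + d := by nlinarith
  have h3 := hβ.identities.antisymm 1 ((r + 1) * q + d + 0 * q) le_rfl (by omega) (by omega)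
  rw [h1, sum_range_one, bracketCoeff_one] at h3
  simp only [zero_mul, add_zero, Nat.choose_self, Nat.cast_one, mul_one] at h3
  rw [neg_one_pow_mul_add_sub_one hqo hde hd] at h3
  have h4 : β ((r + 1) * q + d) ≠ 0 := fun h0 =>
    hne ((hβ.eq_zero_iff _ hN (by omega)).1 h0)
  by_contra hodd
  rw [Nat.not_even_iff_odd] at hodd
  rw [hodd.neg_one_pow] at h3
  exact mul_ne_zero h2 h4 (by linear_combination h3)

/-- The two-step centralizer ending the intermediate constituent is the second one. -/
theorem second_at_intermediate_end [CharP F p] (hp : p.Prime) {k : ℕ} (hqk : q = p ^ k) (hq : 2 ≤ q)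
    (hqo : Odd q) (H : HasCoeffSequences F P Q)
    (h : InitialPattern P Q q r d 0) (hd : 0 < d) (hdq : d < q) (hde : Even d)
    (hr : 2 ≤ r) (hne : ¬ P ((r + 1) * q + d)) : Q ((r + 1) * q + d) := by
  have hrq : 2 * q ≤ r * q := Nat.mul_le_mul_right q hr
  have hrq1 : (r + 1) * q = r * q + q := by ring
  have hgap := h.gap hp hqk hq H hd hr (by simpa using hne)
  simp only [zero_mul, add_zero] at hgap
  have hgap' : ∀ l, (r + 1) * q + d < l → l < (r + 1) * q + d + q → P l := fun l h1 h2 => by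
    have := hgap (l - ((r + 1) * q + d)) (by omega) (by omega)
    rwa [Nat.add_sub_cancel' h1.le] at this
  obtain ⟨β, hβ⟩ := H ((r + 1) * q + d) (r * q + 2 * q) fun i h1 h2 h3 => by
    rcases lt_or_gt_of_ne h3 with h4 | h4
    · exact h.or_of_lt h1 (by omega)
    · exact Or.inl (hgap' i h4 (by omega))
  have hz : ∀ l, r * q < l → l ≤ r * q + 2 * q → l ≠ (r + 1) * q + d → β l = 0 :=
    fun l h1 h2 h3 => by
    rcases lt_or_gt_of_ne h3 with h4 | h4
    · refine h.eq_zero hβ (by omega) h2 (by omega) (fun n _ hn => ?_) (by simp)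
      have := Nat.mul_le_mul_right q hn
      omega
    · exact (hβ.eq_zero_iff l (by omega) h2).2 (hgap' l h4 (by omega))
  have h1 : β (r * q) = 1 := h.eq_one_short hq hβ hr le_rfl (by omega)
  have h2 : β (2 * q) = 1 := h.eq_one_short hq hβ le_rfl hr (by omega)
  -- With β_{rq} = β_{2q} = 1 the right-hand side telescopes to the coefficient of [v_{rq}, v_{2q}],
  -- and the left-hand side is 0. The surviving terms of that coefficient are 1 and -β_N.
  have hj := hβ.identities.jacobi (r * q) (2 * q) (by omega) (by omega) le_rfl
  rw [hz (r * q + 2 * q) (by omega) le_rfl (by omega), h1, h2,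
    bracketCoeff_succ β (r * q) (by omega)] at hj
  have h3 : bracketCoeff β (r * q) (2 * q) = 0 := by linear_combination -hj
  rw [bracketCoeff_eq_progressions β (a := r * q) (n := 1) (b := (r + 1) * q + d) (q := q)
    (n' := 1) (by omega) (by omega) (by omega) (by omega)
    fun l h4 h5 h6 h7 => by
      have h6 := h6 0 one_pos
      have h7 := h7 0 one_pos
      rw [zero_mul, add_zero] at h6 h7
      exact hz l (by omega) (by omega) h7, sum_range_one, sum_range_one] at h3
  simp only [zero_mul, add_zero, Nat.sub_self, pow_zero, Nat.choose_zero_right, Nat.cast_one,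
    h1, mul_one] at h3
  rw [show (r + 1) * q + d - r * q = 1 * q + d by omega,
    show 2 * q - 1 = 1 * q + (q - 1) by omega, neg_one_pow_mul_add hqo hde,
    cast_choose_add_mul_pow hp hqk _ _ (by omega) hdq, cast_choose_pow_sub_one hp hqk hdq,
    hde.neg_one_pow] at h3
  refine (hβ.eq_one_iff _ (by omega) (by omega)).1 ?_
  simp only [Nat.choose_self, Nat.cast_one] at h3
  linear_combination -h3

/-- Anticommutativity of v_1 and v_{(r+2)q}, where β vanishes. The residue of the upper entry is q -
1 here, so the ends hq do contribute, and the result is the alternating sum of (r + 1 choose ·) with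
a few terms altered. -/
theorem cast_eq_zero [CharP F p] (hp : p.Prime) {k : ℕ} (hqk : q = p ^ k) (hq : 2 ≤ q)
    (hqo : Odd q) (H : HasCoeffSequences F P Q)
    (h : InitialPattern P Q q r d 1) (hd : 0 < d) (hdq : d < q) (hde : Even d)
    (hr : 2 ≤ r) (hre : Even (r + 1)) : (r : F) = 0 := by
  have hrq : 2 * q ≤ r * q := Nat.mul_le_mul_right q hr
  have hrq1 : (r + 1) * q = r * q + q := by ring
  have hrq2 : 2 * q + (r - 1) * q = (r + 1) * q := by
    rw [← add_mul]; congr 1; omega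
  obtain ⟨β, hβ⟩ := H 0 (r * q + 2 * q) fun i h1 h2 _ => h.or_of_lt h1 (by omega)
  have hw : β (r * q + 2 * q) = 0 := by
    refine h.eq_zero hβ (by omega) le_rfl (by omega) (fun n _ hn => ?_) fun f hf => ?_
    · have := Nat.mul_le_mul_right q hn
      omega
    · rw [show f = 0 by omega]
      omega
  have hN : β ((r + 1) * q + d) = 1 := by
    simpa using h.eq_one_later hq hβ (f := 0) one_pos (by omega)
  have h3 := hβ.identities.antisymm 1 (r * q + 2 * q) le_rfl (by omega) (by omega)
  rw [bracketCoeff_one, hw, bracketCoeff_eq_progressions β (a := 2 * q) (n := r - 1)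
    (b := (r + 1) * q + d) (q := q) (n' := 1) (by omega) (by omega) (by omega) (by omega),
    sum_range_one, zero_mul, add_zero, hN,
    show (r + 1) * q + d - 1 = (r + 1) * q + (d - 1) by omega,
    show r * q + 2 * q - 1 = (r + 1) * q + (q - 1) by omega,
    neg_one_pow_mul_add_sub_one hqo hde hd,
    cast_choose_add_mul_pow hp hqk _ _ (by omega) (by omega),
    cast_choose_pow_sub_one hp hqk (by omega), hre.neg_one_pow,
    (Nat.Even.sub_odd hd hde odd_one).neg_one_pow] at h3
  · have h4 : ∀ t ∈ range (r - 1), (-1 : F) ^ (2 * q + t * q - 1) *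
        (((r + 1) * q + (q - 1)).choose (2 * q + t * q - 1) : F) * β (2 * q + t * q)
        = (-1) ^ (t + 1) * ((r + 1).choose (t + 1) : F) := fun t ht => by
      have ht := mem_range.1 ht
      have h5 : (-1 : F) ^ ((t + 1) * q + (q - 1)) = (-1) ^ (t + 1) :=
        neg_one_pow_mul_add hqo (Nat.Odd.sub_odd hqo odd_one) _
      rw [show 2 * q + t * q - 1 = (t + 1) * q + (q - 1) by rw [add_mul]; omega,
        cast_choose_add_mul_pow hp hqk _ _ (by omega) (by omega), h5, ← add_mul,
        h.eq_one_short hq hβ (by omega) (by omega) (by omega)]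
      simp
    rw [sum_congr rfl h4] at h3
    have h6 := alternating_sum_choose_eq_zero (F := F) (n := r + 1) (by omega)
    rw [sum_range_succ, sum_range_succ, show r = r - 1 + 1 by omega, sum_range_succ',
      show r - 1 + 1 = r by omega, hre.neg_one_pow, Nat.choose_self, Nat.choose_succ_self_right,
      (Nat.not_even_iff_odd.1 fun h7 => (Nat.even_add_one.1 hre) h7 : Odd r).neg_one_pow] at h6
    simp only [pow_zero, Nat.choose_zero_right, Nat.choose_self, Nat.cast_one, Nat.cast_add] at h3 h6
    linear_combination h3 - h6
  · intro l h1 h2 h3 h4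
    by_cases h5 : l = r * q + 2 * q
    · exact h5 ▸ hw
    refine h.eq_zero hβ h1 (by omega) (by omega) (fun n hn hnr hl => ?_) fun f hf => h4 f (by omega)
    refine h3 (n - 2) (by omega) ?_
    rw [← add_mul, hl]; congr 1; omega

/-- Jacobi for v_{lq}, v_{Mq+d}, y, where β_{lq} = 1 and β_{Mq+d} = 0. If A is the truncated sum and
g the unknown β, it becomes (g - 1)(A + 1) = 0. -/
theorem second_of_sum_ne [CharP F p] (hp : p.Prime) {k : ℕ} (hqk : q = p ^ k) (hq : 2 ≤ q)
    (hqo : Odd q) (H : HasCoeffSequences F P Q)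
    (h : InitialPattern P Q q r d e) (hd : 0 < d) (hdq : d < q) (hde : Even d)
    {l M : ℕ} (hl : 2 ≤ l) (hlr : l ≤ r) (hel : e < l) (hM : l + M = r + 1 + e) (hMe : Even M)
    (hsum : ∑ t ∈ range (r - l + 1), (-1 : F) ^ t * (M.choose t : F) + 1 ≠ 0) :
    Q ((r + 1) * q + d + e * q) := by
  obtain ⟨β, hβ⟩ := h.exists_coeff H
  have hlq : 2 * q ≤ l * q := Nat.mul_le_mul_right q hl
  have hlrq : l * q ≤ r * q := Nat.mul_le_mul_right q hlr
  have hrq1 : (r + 1) * q = r * q + q := by ring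
  have hMq : l * q + M * q = (r + 1) * q + e * q := by rw [← add_mul, hM, add_mul]
  have hMq1 : q ≤ M * q := Nat.le_mul_of_pos_left q (by omega)
  have hMr : M * q ≤ r * q := Nat.mul_le_mul_right q (by omega)
  have hlq1 : l * q + (r - l + 1) * q = (r + 1) * q := by
    rw [← add_mul]; congr 1; omega
  have hi : β (l * q) = 1 := h.eq_one_short hq hβ hl hlr (by omega)
  have hj : β (M * q + d) = 0 := by
    refine h.eq_zero hβ (by omega) (by omega) (by omega) (fun n _ _ => mul_add_ne_mul hd hdq)
      fun f _ => ?_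
    have := Nat.zero_le (f * q)
    omega
  set A := ∑ t ∈ range (r - l + 1), (-1 : F) ^ t * (M.choose t : F) with hA
  set g := β ((r + 1) * q + d + e * q) with hg
  have hsupp : ∀ n, l * q ≤ n → n ≤ (r + 1) * q + d + e * q →
      (∀ t < r - l + 1, n ≠ l * q + t * q) → (∀ f < e, n ≠ (r + 1) * q + d + f * q) →
      n ≠ (r + 1) * q + d + e * q → β n = 0 := fun n h1 h2 h3 h4 h5 => by
    refine h.eq_zero hβ (by omega) h2 (by omega) (fun m _ hmr hmn => ?_) h4
    have hlm : l ≤ m := by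
      by_contra hlt
      have : (m + 1) * q ≤ l * q := Nat.mul_le_mul_right q (by omega)
      rw [add_mul, one_mul] at this
      omega
    refine h3 (m - l) (by omega) ?_
    rw [← add_mul, hmn]; congr 1; omega
  have hexp : ∀ f, (r + 1) * q + d + f * q - l * q = (r - l + 1 + f) * q + d := fun f => by
    rw [add_mul (r - l + 1)]; omega
  have hshort : ∀ c < q, ∑ t ∈ range (r - l + 1), (-1) ^ (l * q + t * q - l * q) *
      ((M * q + c).choose (l * q + t * q - l * q) : F) * β (l * q + t * q) = A := fun c hc => by
    refine sum_congr rfl fun t ht => ?_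
    have ht := mem_range.1 ht
    have h5 : (-1 : F) ^ (t * q + 0) = (-1) ^ t := neg_one_pow_mul_add hqo Even.zero _
    have h6 := cast_choose_add_mul_pow (F := F) hp hqk M t hc (show 0 < q by omega)
    rw [add_zero] at h5 h6
    rw [Nat.add_sub_cancel_left, ← add_mul, h.eq_one_short hq hβ (by omega) (by omega) (by omega),
      h5, h6]
    simp
  have hc0 : bracketCoeff β (l * q) (M * q + d) = A := by
    rw [bracketCoeff_eq_progressions β (a := l * q) (n := r - l + 1) (b := (r + 1) * q + d)
      (q := q) (n' := e) (by omega) (by omega) (by omega) (by omega)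
      fun n h1 h2 h3 h4 => hsupp n h1 (by omega) h3 h4 (by omega),
      show M * q + d - 1 = M * q + (d - 1) by omega, hshort _ (by omega), sum_eq_zero, add_zero]
    intro f hf
    rw [hexp, cast_choose_add_mul_pow hp hqk _ _ (by omega) hdq,
      Nat.choose_eq_zero_of_lt (n := d - 1) (by omega)]
    simp
  -- Raising the residue from d - 1 to d switches on the ends from N on. The sum is then the full
  -- alternating sum for `M`, which is 0, with its last term 1 replaced by g.
  have hc1 : bracketCoeff β (l * q) (M * q + d + 1) = g - 1 := by
    rw [bracketCoeff_eq_progressions β (a := l * q) (n := r - l + 1) (b := (r + 1) * q + d)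
      (q := q) (n' := e + 1) (by omega) (by omega) (by omega) (by omega)
      fun n h1 h2 h3 h4 => hsupp n h1 (by omega) h3 (fun f hf => h4 f (by omega))
        (h4 e (by omega)), Nat.add_sub_cancel, hshort _ hdq]
    have hterm : ∀ f, (-1 : F) ^ ((r + 1) * q + d + f * q - l * q) *
        ((M * q + d).choose ((r + 1) * q + d + f * q - l * q) : F)
        = (-1) ^ (r - l + 1 + f) * (M.choose (r - l + 1 + f) : F) := fun f => by
      rw [hexp, cast_choose_add_mul_pow hp hqk _ _ hdq hdq, neg_one_pow_mul_add hqo hde]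
      simp
    simp only [hterm]
    have hone : ∀ f ∈ range e, (-1 : F) ^ (r - l + 1 + f) * (M.choose (r - l + 1 + f) : F) *
        β ((r + 1) * q + d + f * q) =
        (-1) ^ (r - l + 1 + f) * (M.choose (r - l + 1 + f) : F) := fun f hf => by
      have hf := mem_range.1 hf
      have : f * q ≤ e * q := Nat.mul_le_mul_right q hf.le
      rw [h.eq_one_later hq hβ hf (by omega), mul_one]
    rw [sum_range_succ, sum_congr rfl hone, show r - l + 1 + e = M by omega, Nat.choose_self,
      hMe.neg_one_pow]
    have hfull := alternating_sum_choose_eq_zero (F := F) (n := M) (by omega)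
    rw [sum_range_succ, show range M = range (r - l + 1 + e) by congr 1; omega, sum_range_add,
      Nat.choose_self, hMe.neg_one_pow] at hfull
    simp only [Nat.cast_one] at hfull ⊢
    linear_combination hfull
  have hjac := hβ.identities.jacobi (l * q) (M * q + d) (by omega) (by omega) (by omega)
  have hs := bracketCoeff_succ β (l * q) (j := M * q + d) (by omega)
  rw [show l * q + (M * q + d) = (r + 1) * q + d + e * q by omega, ← hg, hi, hj, hc0] at hjac
  rw [hc0, hc1] at hs
  refine (hβ.eq_one_iff _ (by omega) le_rfl).1 ?_
  have : (g - 1) * (A + 1) = 0 := by linear_combination hjac + hs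
  exact sub_eq_zero.1 ((mul_eq_zero.1 this).resolve_right hsum)

/-- The choice of l must make M even and A + 1 nonzero. For odd e, M = e + 1 gives A = 1. For even
e, M = p^n + 1 gives A = ± (p^n choose p^n - e) = 0, since parity excludes e = p^n. -/
theorem second_of_lt [CharP F p] (hp : p.Prime) {k : ℕ} (hqk : q = p ^ k) (hq : 2 ≤ q)
    (hqo : Odd q) (h2 : (2 : F) ≠ 0) (H : HasCoeffSequences F P Q)
    (h : InitialPattern P Q q r d e) (hd : 0 < d) (hdq : d < q) (hde : Even d)
    {n : ℕ} (hn : Odd (p ^ n)) (hnr : p ^ n < r) (he : 1 ≤ e) (hen : e ≤ p ^ n) :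
    Q ((r + 1) * q + d + e * q) := by
  rcases Nat.even_or_odd e with hee | heo
  · have hne : e ≠ p ^ n := fun h3 => by
      rw [h3] at hee
      exact Nat.not_even_iff_odd.2 hn hee
    have he2 : 2 ≤ e := by
      obtain ⟨c, hc⟩ := hee
      omega
    refine h.second_of_sum_ne hp hqk hq hqo H hd hdq hde (l := r + e - p ^ n) (M := p ^ n + 1)
      (by omega) (by omega) (by omega) (by omega) (hn.add_odd odd_one) ?_
    rw [alternating_sum_choose_range, show r - (r + e - p ^ n) = p ^ n - e by omega,
      (CharP.cast_eq_zero_iff F p _).2 (hp.dvd_choose_pow (by omega) (by omega))]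
    simp
  · refine h.second_of_sum_ne hp hqk hq hqo H hd hdq hde (l := r) (M := e + 1)
      (by omega) le_rfl (by omega) (by omega) (heo.add_odd odd_one) ?_
    rw [Nat.sub_self, zero_add, sum_range_one]
    simpa [one_add_one_eq_two] using h2

/-- Anticommutativity of v_1 and v_{N+eq} evaluates the tail of the alternating sum of (r + 1 + e
choose ·); the complementary initial segment is -(r + e choose r), as r is odd. -/
theorem cast_choose_eq_one [CharP F p] (hp : p.Prime) {k : ℕ} (hqk : q = p ^ k) (hq : 2 ≤ q)
    (hqo : Odd q) (H : HasCoeffSequences F P Q)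
    (h : InitialPattern P Q q r d (e + 1)) (hd : 0 < d) (hdq : d < q) (hde : Even d)
    (hr : 2 ≤ r) (hre : Even (r + 1)) : ((r + e).choose r : F) = 1 := by
  have h' : InitialPattern P Q q r d e := by
    refine ⟨h.short, fun f hf => h.later f (by omega), fun l h1 h2 h3 h4 => ?_⟩
    have heq : (e + 1) * q = e * q + q := by ring
    refine h.rest l h1 (by omega) h3 fun f hf => ?_
    rcases Nat.lt_succ_iff_lt_or_eq.1 hf with hf | rfl
    exacts [h4 f hf, h2.ne]
  have hN : 2 ≤ (r + 1) * q + d + e * q := by nlinarith [Nat.zero_le (e * q)]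
  obtain ⟨β, hβ⟩ := h'.exists_coeff H
  have h3 := hβ.identities.antisymm 1 ((r + 1) * q + d + e * q) le_rfl (by omega) (by omega)
  rw [h'.bracketCoeff_one_left hp hqk hq hd hdq hr hβ, bracketCoeff_one,
    h.eq_one_later hq hβ (Nat.lt_succ_self e) le_rfl] at h3
  have hterm : ∀ f ∈ range (e + 1), (-1 : F) ^ ((r + 1 + f) * q + (d - 1)) *
      ((r + 1 + e).choose (r + 1 + f) : F) * β ((r + 1) * q + d + f * q)
      = -((-1) ^ (r + 1 + f) * ((r + 1 + e).choose (r + 1 + f) : F)) := fun f hf => by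
    have hf := mem_range.1 hf
    have : f * q ≤ e * q := Nat.mul_le_mul_right q (by omega)
    rw [h.eq_one_later hq hβ hf (by omega), neg_one_pow_mul_add_sub_one hqo hde hd]
    ring
  rw [sum_congr rfl hterm, sum_neg_distrib] at h3
  have hfull := alternating_sum_choose_eq_zero (F := F) (n := r + 1 + e) (by omega)
  rw [show r + 1 + e + 1 = r + 1 + (e + 1) by ring, sum_range_add] at hfull
  have hpart := alternating_sum_choose_range (F := F) (r + e) r
  rw [show r + e + 1 = r + 1 + e by ring,
    (Nat.not_even_iff_odd.1 fun h7 => (Nat.even_add_one.1 hre) h7 : Odd r).neg_one_pow] at hpart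
  linear_combination hpart - hfull - h3

theorem eq_prime_pow [CharP F p] (hp : p.Prime) (hodd : Odd p) {k : ℕ} (hqk : q = p ^ k)
    (hq : 2 ≤ q) (H : HasCoeffSequences F P Q)
    (h : InitialPattern P Q q r d 0) (hd : 0 < d) (hdq : d < q) (hde : Even d)
    (hr : 2 ≤ r) (hne : ¬ P ((r + 1) * q + d)) : ∃ n, r = p ^ n := by
  have hqo : Odd q := hqk ▸ hodd.pow
  have h2 : (2 : F) ≠ 0 := two_ne_zero_of_odd_prime hp hodd
  have hre := h.even_succ hp hqk hq hqo h2 H hd hdq hde hr hne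
  have hQ := h.second_at_intermediate_end hp hqk hq hqo H hd hdq hde hr hne
  have h1 := h.succ hp hqk hq H hd hr (by simpa using hQ)
  have hr0 := h1.cast_eq_zero hp hqk hq hqo H hd hdq hde hr hre
  obtain ⟨n, u, hu, hru⟩ := Nat.exists_eq_pow_mul_and_not_dvd (show r ≠ 0 by omega) p hp.ne_one
  refine ⟨n, ?_⟩
  by_contra hrn
  have hlt : p ^ n < r := lt_of_le_of_ne (Nat.le_of_dvd (by omega) ⟨u, hru⟩) (Ne.symm hrn)
  -- The pattern must reach N + p^n q inclusive. The case n = 0, where p ∤ r, is not special: then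
  -- only e = 1 has to be forced.
  have hpat : ∀ e, e ≤ p ^ n → InitialPattern P Q q r d (e + 1) := by
    intro e
    induction e with
    | zero => exact fun _ => h1
    | succ e ih =>
      intro he
      have h3 := ih (by omega)
      exact h3.succ hp hqk hq H hd hr
        (h3.second_of_lt hp hqk hq hqo h2 H hd hdq hde hodd.pow hlt (by omega) he)
  have h4 := (hpat _ le_rfl).cast_choose_eq_one hp hqk hq hqo H hd hdq hde hr hre
  have : Fact p.Prime := ⟨hp⟩
  have h5 := (CharP.natCast_eq_natCast F p).2
    (Choose.choose_pow_mul_pow_mul_modEq_choose_nat (p := p) (k := n) (a := u + 1) (b := u))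
  rw [mul_add, mul_one, ← hru, h4, Nat.choose_succ_self_right, Nat.cast_add, Nat.cast_one] at h5
  refine hu ((CharP.cast_eq_zero_iff F p u).1 ?_)
  linear_combination -h5

end InitialPattern

end Pattern

/-! ### From the Lie algebra to coefficient sequences -/

section Lie

variable {F L : Type*} [Field F] [LieRing L] [LieAlgebra F L] {𝓛 : ℕ → Submodule F L}

theorem bracket_mem_succ [GradedLieAlgebra 𝓛] {i : ℕ} {a u : L} (ha : a ∈ 𝓛 i) (hu : u ∈ 𝓛 1) :
    ⁅a, u⁆ ∈ 𝓛 (i + 1) :=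
  SetLike.GradedBracket.bracket_mem ha hu

namespace IsMaximalClass

variable [GradedLieAlgebra 𝓛]

theorem finiteDimensional (hL : IsMaximalClass 𝓛) (i : ℕ) : FiniteDimensional F (𝓛 i) := by
  rw [FiniteDimensional, ← Module.rank_lt_aleph0_iff]
  rcases Nat.lt_or_ge i 2 with h | h
  · interval_cases i
    · rw [hL.zero_eq_bot]; simpa using Cardinal.aleph0_pos
    · rw [hL.rank_one]; exact Cardinal.natCast_lt_aleph0 (n := 2)
  · exact (hL.rank_le_one i h).trans_lt Cardinal.one_lt_aleph0

theorem finrank_one (hL : IsMaximalClass 𝓛) : Module.finrank F (𝓛 1) = 2 := by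
  rw [Module.finrank, hL.rank_one]; simp

/-- Otherwise K = L_1 + … + L_i (with L_0 = 0) is stable under bracketing with L_1, hence with all
of `L` by generation. It is then a subalgebra containing L_1, so L = K is finite-dimensional. -/
theorem exists_bracket_ne_zero (hL : IsMaximalClass 𝓛) (hinf : ¬ FiniteDimensional F L) {i : ℕ}
    (hi : 1 ≤ i) : ∃ a ∈ 𝓛 i, ∃ u ∈ 𝓛 1, ⁅a, u⁆ ≠ 0 := by
  by_contra! hzero
  refine hinf ?_
  let K : Submodule F L := ⨆ j : Fin (i + 1), 𝓛 j
  have hle : ∀ j, j ≤ i → 𝓛 j ≤ K := fun j hj =>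
    le_iSup (fun j : Fin (i + 1) => 𝓛 j) ⟨j, Nat.lt_succ_of_le hj⟩
  have : ∀ j : Fin (i + 1), FiniteDimensional F (𝓛 j) := fun j => hL.finiteDimensional j
  have hK : FiniteDimensional F K := Submodule.finiteDimensional_iSup _
  let N : LieSubalgebra F L :=
    { carrier := {u | ∀ k ∈ K, ⁅k, u⁆ ∈ K}
      add_mem' := fun {a b} ha hb k hk => by
        rw [lie_add]; exact add_mem (ha k hk) (hb k hk)
      zero_mem' := fun k _ => by rw [lie_zero]; exact zero_mem K
      smul_mem' := fun c a ha k hk => by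
        rw [lie_smul]; exact K.smul_mem c (ha k hk)
      lie_mem' := fun {a b} ha hb k hk => by
        have : ⁅k, ⁅a, b⁆⁆ = ⁅⁅k, a⁆, b⁆ - ⁅⁅k, b⁆, a⁆ := by
          rw [leibniz_lie, ← lie_skew ⁅k, b⁆ a]; abel
        rw [this]
        exact sub_mem (hb _ (ha k hk)) (ha _ (hb k hk)) }
  have hN : N = ⊤ := by
    rw [eq_top_iff, ← hL.generated, LieSubalgebra.lieSpan_le]
    intro u hu k hk
    refine Submodule.iSup_induction (fun j : Fin (i + 1) => 𝓛 j)
      (motive := fun k => ⁅k, u⁆ ∈ K) hk (fun j a ha => ?_) (by simp) fun a b ha hb => ?_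
    · rcases Nat.lt_or_ge j.1 i with h | h
      · exact hle (j + 1) h (bracket_mem_succ ha hu)
      · have hj : (j : ℕ) = i := le_antisymm (Nat.lt_succ_iff.1 j.2) h
        rw [hzero a (hj ▸ ha) u hu]
        exact zero_mem K
    · rw [add_lie]; exact add_mem ha hb
  let K' : LieSubalgebra F L :=
    { K with
      lie_mem' := fun {a b} ha _ => (hN ▸ LieSubalgebra.mem_top b : b ∈ N) a ha }
  have hK' : K' = ⊤ := by
    rw [eq_top_iff, ← hL.generated, LieSubalgebra.lieSpan_le]
    exact hle 1 hi
  have hKtop : K = ⊤ := by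
    rw [eq_top_iff]
    intro u _
    exact (hK' ▸ LieSubalgebra.mem_top u : u ∈ K')
  rw [hKtop] at hK
  exact Module.finite_def.2 ((Submodule.fg_top _).1 (Module.finite_def.1 hK))

theorem exists_eq_smul (hL : IsMaximalClass 𝓛) {i : ℕ} (hi : 2 ≤ i) {v w : L} (hv : v ∈ 𝓛 i)
    (hv0 : v ≠ 0) (hw : w ∈ 𝓛 i) : ∃ c : F, w = c • v := by
  obtain ⟨u, hu⟩ := rank_le_one_iff.1 (hL.rank_le_one i hi)
  obtain ⟨a, ha⟩ := hu ⟨v, hv⟩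
  obtain ⟨b, hb⟩ := hu ⟨w, hw⟩
  have ha' : a • (u : L) = v := congrArg Subtype.val ha
  have hb' : b • (u : L) = w := congrArg Subtype.val hb
  have ha0 : a ≠ 0 := by
    rintro rfl
    exact hv0 (by rw [← ha', zero_smul])
  exact ⟨b * a⁻¹, by rw [← ha', ← hb', smul_smul, inv_mul_cancel_right₀ ha0]⟩

theorem mem_twoStepCentralizer (hL : IsMaximalClass 𝓛) {i : ℕ} (hi : 2 ≤ i) {v u : L}
    (hv : v ∈ 𝓛 i) (hv0 : v ≠ 0) (hu : u ∈ 𝓛 1) :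
    u ∈ twoStepCentralizer 𝓛 i ↔ ⁅v, u⁆ = 0 := by
  refine ⟨fun h => h.2 v hv, fun h => ⟨hu, fun w hw => ?_⟩⟩
  obtain ⟨c, rfl⟩ := hL.exists_eq_smul hi hv hv0 hw
  rw [smul_lie, h, smul_zero]

theorem twoStepCentralizer_lt (hL : IsMaximalClass 𝓛) (hinf : ¬ FiniteDimensional F L) {i : ℕ}
    (hi : 2 ≤ i) : twoStepCentralizer 𝓛 i < 𝓛 1 := by
  refine lt_of_le_of_ne (fun u hu => hu.1) fun h => ?_
  obtain ⟨a, ha, u, hu, hau⟩ := hL.exists_bracket_ne_zero hinf (i := i) (by omega)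
  rw [← h] at hu
  exact hau (hu.2 a ha)

theorem twoStepCentralizer_eq_span (hL : IsMaximalClass 𝓛) (hinf : ¬ FiniteDimensional F L)
    {i : ℕ} (hi : 2 ≤ i) {u : L} (hu : u ∈ twoStepCentralizer 𝓛 i) (hu0 : u ≠ 0) :
    twoStepCentralizer 𝓛 i = Submodule.span F {u} := by
  have := hL.finiteDimensional 1
  have hlt := hL.twoStepCentralizer_lt hinf hi
  have : FiniteDimensional F (twoStepCentralizer 𝓛 i) :=
    Submodule.finiteDimensional_of_le hlt.le
  have h1 := Submodule.finrank_lt_finrank_of_lt hlt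
  rw [hL.finrank_one] at h1
  symm
  refine Submodule.eq_of_le_of_finrank_le ?_ ?_
  · rw [Submodule.span_singleton_le_iff_mem]; exact hu
  · rw [finrank_span_singleton hu0]; omega

theorem twoStepCentralizer_eq_of_mem (hL : IsMaximalClass 𝓛) (hinf : ¬ FiniteDimensional F L)
    {i j : ℕ} (hi : 2 ≤ i) (hj : 2 ≤ j) {u : L} (hu0 : u ≠ 0)
    (hui : u ∈ twoStepCentralizer 𝓛 i) (huj : u ∈ twoStepCentralizer 𝓛 j) :
    twoStepCentralizer 𝓛 i = twoStepCentralizer 𝓛 j := by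
  rw [hL.twoStepCentralizer_eq_span hinf hi hui hu0, hL.twoStepCentralizer_eq_span hinf hj huj hu0]

theorem exists_mem_twoStepCentralizer (hL : IsMaximalClass 𝓛) (hinf : ¬ FiniteDimensional F L)
    {i : ℕ} (hi : 2 ≤ i) : ∃ u ∈ twoStepCentralizer 𝓛 i, u ≠ 0 := by
  obtain ⟨v, hv, u, hu, hvu⟩ := hL.exists_bracket_ne_zero hinf (i := i) (by omega)
  have hv0 : v ≠ 0 := by
    rintro rfl
    exact hvu (zero_lie u)
  obtain ⟨b, hb, hbu⟩ : ∃ b ∈ 𝓛 1, b ∉ Submodule.span F {u} := by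
    by_contra! hall
    have h1 := Submodule.finrank_mono (show 𝓛 1 ≤ Submodule.span F {u} from hall)
    have h2 := finrank_span_le_card (R := F) ({u} : Set L)
    rw [hL.finrank_one] at h1
    simp at h2
    omega
  obtain ⟨c, hc⟩ := hL.exists_eq_smul (by omega) (bracket_mem_succ hv hu) hvu
    (bracket_mem_succ hv hb)
  refine ⟨b - c • u, ?_, fun h0 => hbu ?_⟩
  · rw [hL.mem_twoStepCentralizer hi hv hv0 (sub_mem hb ((𝓛 1).smul_mem c hu)), lie_sub, lie_smul,
      hc, sub_self]
  · rw [sub_eq_zero.1 h0]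
    exact Submodule.smul_mem _ c (Submodule.mem_span_singleton_self u)

end IsMaximalClass

/-- The elements `v_1 = y`, `v_{i+1} = [v_i, z]`; here `v_0` is a dummy value. -/
def ladder (y z : L) : ℕ → L
  | 0 => 0
  | 1 => y
  | n + 2 => ⁅ladder y z (n + 1), z⁆

theorem ladder_succ (y z : L) {n : ℕ} (hn : 1 ≤ n) : ladder y z (n + 1) = ⁅ladder y z n, z⁆ := by
  obtain ⟨m, rfl⟩ : ∃ m, n = m + 1 := ⟨n - 1, by omega⟩
  rfl

theorem ladder_mem [GradedLieAlgebra 𝓛] {y z : L} (hy : y ∈ 𝓛 1) (hz : z ∈ 𝓛 1) {n : ℕ}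
    (hn : 1 ≤ n) : ladder y z n ∈ 𝓛 n := by
  induction n, hn using Nat.le_induction with
  | base => exact hy
  | succ n hn ih =>
    rw [ladder_succ y z hn]
    exact bracket_mem_succ ih hz

theorem lie_ladder {y z : L} {W : ℕ} {β : ℕ → F}
    (hβ : ∀ i, 1 ≤ i → i ≤ W → ⁅ladder y z i, y⁆ = β i • ladder y z (i + 1)) {j : ℕ} (hj : 1 ≤ j) :
    ∀ i, 1 ≤ i → i + j ≤ W + 1 →
      ⁅ladder y z i, ladder y z j⁆ = bracketCoeff β i j • ladder y z (i + j) := by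
  induction j, hj using Nat.le_induction with
  | base =>
    intro i hi hij
    rw [bracketCoeff_one]
    exact hβ i hi (by omega)
  | succ j hj ih =>
    intro i hi hij
    have h : ⁅ladder y z i, ⁅ladder y z j, z⁆⁆
        = ⁅⁅ladder y z i, ladder y z j⁆, z⁆ - ⁅⁅ladder y z i, z⁆, ladder y z j⁆ := by
      rw [leibniz_lie, ← lie_skew ⁅ladder y z i, z⁆ (ladder y z j)]; abel
    rw [ladder_succ y z hj, h, ih i hi (by omega), smul_lie, ← ladder_succ y z (by omega),
      ← ladder_succ y z hi, ih (i + 1) (by omega) (by omega), bracketCoeff_succ β i hj, sub_smul,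
      show i + 1 + j = i + j + 1 by ring, show i + (j + 1) = i + j + 1 by ring]

theorem lie_lie_ladder {y z : L} {W : ℕ} {β : ℕ → F}
    (hβ : ∀ i, 1 ≤ i → i ≤ W → ⁅ladder y z i, y⁆ = β i • ladder y z (i + 1)) {i j : ℕ}
    (hi : 1 ≤ i) (hj : 1 ≤ j) (hij : i + j ≤ W + 1) :
    bracketCoeff β i j • ⁅ladder y z (i + j), y⁆ =
      β i • ⁅ladder y z (i + 1), ladder y z j⁆ + β j • ⁅ladder y z i, ladder y z (j + 1)⁆ := by
  rw [← smul_lie, ← lie_ladder hβ hj i hi hij, ← smul_lie, ← lie_smul, ← hβ i hi (by omega),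
    ← hβ j hj (by omega), lie_lie, leibniz_lie (ladder y z i), ← lie_skew _ ⁅ladder y z i, y⁆]
  abel_nf

/-- The ladder stays nonzero as long as z = x + y lies in no centralizer up to degree `W`. This is
automatic where C_i is spanned by x or y; only the exceptional degree `n` needs care. -/
theorem IsMaximalClass.hasCoeffSequences [GradedLieAlgebra 𝓛] (hL : IsMaximalClass 𝓛)
    (hinf : ¬ FiniteDimensional F L) (h2 : (2 : F) ≠ 0) {s : ℕ} (hs : 2 ≤ s)
    (hne : twoStepCentralizer 𝓛 s ≠ twoStepCentralizer 𝓛 2) :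
    HasCoeffSequences F (fun i => twoStepCentralizer 𝓛 i = twoStepCentralizer 𝓛 2)
      fun i => twoStepCentralizer 𝓛 i = twoStepCentralizer 𝓛 s := by
  intro n W hW
  obtain ⟨x, hx, hx0⟩ := hL.exists_mem_twoStepCentralizer hinf hs
  have hfin := hL.finiteDimensional 1
  have hxC : ∀ i, 2 ≤ i → (x ∈ twoStepCentralizer 𝓛 i ↔
      twoStepCentralizer 𝓛 i = twoStepCentralizer 𝓛 s) := fun i hi =>
    ⟨fun h => hL.twoStepCentralizer_eq_of_mem hinf hi hs hx0 h hx, fun h => h ▸ hx⟩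
  -- If C_n contains x + y, replace y by -y: C_n cannot contain both x + y and x - y, since 2 is
  -- invertible and C_n would then contain x and y.
  obtain ⟨y, hy, hy0, hyn⟩ : ∃ y ∈ twoStepCentralizer 𝓛 2, y ≠ 0 ∧
      (2 ≤ n → x + y ∉ twoStepCentralizer 𝓛 n) := by
    obtain ⟨y, hy, hy0⟩ := hL.exists_mem_twoStepCentralizer hinf (le_refl 2)
    by_cases hn : 2 ≤ n ∧ x + y ∈ twoStepCentralizer 𝓛 n
    · refine ⟨-y, neg_mem hy, neg_ne_zero.2 hy0, fun hn2 hmem => hne ?_⟩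
      have hx2 : x ∈ twoStepCentralizer 𝓛 n := by
        have := (twoStepCentralizer 𝓛 n).smul_mem (2 : F)⁻¹ (add_mem hn.2 hmem)
        rwa [show x + y + (x + -y) = (2 : F) • x by rw [two_smul]; abel, smul_smul,
          inv_mul_cancel₀ h2, one_smul] at this
      have hy2 : y ∈ twoStepCentralizer 𝓛 n := by
        have := sub_mem hn.2 hx2
        rwa [add_sub_cancel_left] at this
      rw [← (hxC n hn2).1 hx2]
      exact hL.twoStepCentralizer_eq_of_mem hinf hn2 le_rfl hy0 hy2 hy
    · exact ⟨y, hy, hy0, fun h3 h4 => hn ⟨h3, h4⟩⟩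
  have hyC : ∀ i, 2 ≤ i → (y ∈ twoStepCentralizer 𝓛 i ↔
      twoStepCentralizer 𝓛 i = twoStepCentralizer 𝓛 2) := fun i hi =>
    ⟨fun h => hL.twoStepCentralizer_eq_of_mem hinf hi le_rfl hy0 h hy, fun h => h ▸ hy⟩
  set z := x + y with hz
  have hz1 : z ∈ 𝓛 1 := add_mem hx.1 hy.1
  have hzC : ∀ i, 2 ≤ i → i ≤ W → z ∉ twoStepCentralizer 𝓛 i := fun i hi hiW hmem => by
    by_cases hin : i = n
    · exact hyn (hin ▸ hi) (hin ▸ hmem)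
    rcases hW i hi hiW hin with h | h
    · have h3 := (hyC i hi).2 h
      have h4 := sub_mem hmem h3
      rw [hz, add_sub_cancel_right] at h4
      exact hne (((hxC i hi).1 h4).symm.trans h)
    · have h3 := (hxC i hi).2 h
      have h4 := sub_mem hmem h3
      rw [hz, add_sub_cancel_left] at h4
      exact hne (h.symm.trans ((hyC i hi).1 h4))
  set v := ladder y z with hv
  have hvmem : ∀ i, 1 ≤ i → v i ∈ 𝓛 i := fun i hi => ladder_mem hy.1 hz1 hi
  have hspan : Submodule.span F {x, y} = 𝓛 1 := by
    refine Submodule.eq_of_le_of_finrank_le ?_ ?_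
    · rw [Submodule.span_le]
      rintro u (rfl | rfl)
      exacts [hx.1, hy.1]
    · have hlt : twoStepCentralizer 𝓛 2 < Submodule.span F {x, y} := by
        rw [hL.twoStepCentralizer_eq_span hinf le_rfl hy hy0]
        refine lt_of_le_of_ne (Submodule.span_mono (by simp)) fun h => hne ?_
        rw [← hL.twoStepCentralizer_eq_span hinf le_rfl hy hy0] at h
        exact ((hxC 2 le_rfl).1 (h ▸ Submodule.subset_span (by simp))).symm
      have : FiniteDimensional F (Submodule.span F {x, y}) :=
        FiniteDimensional.span_of_finite F (by simp)
      have h3 := Submodule.finrank_lt_finrank_of_lt hlt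
      rw [hL.twoStepCentralizer_eq_span hinf le_rfl hy hy0, finrank_span_singleton hy0] at h3
      rw [hL.finrank_one]
      omega
  have hv2 : v 2 ≠ 0 := by
    intro h0
    have hyx : ⁅y, x⁆ = 0 := by
      have : ⁅y, x + y⁆ = 0 := h0
      rwa [lie_add, lie_self, add_zero] at this
    have hxy : ⁅x, y⁆ = 0 := by rw [← lie_skew, hyx, neg_zero]
    obtain ⟨a, ha, u, hu, hau⟩ := hL.exists_bracket_ne_zero hinf (le_refl 1)
    rw [← hspan, Submodule.mem_span_pair] at ha hu
    obtain ⟨a1, a2, rfl⟩ := ha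
    obtain ⟨u1, u2, rfl⟩ := hu
    exact hau (by simp [hyx, hxy])
  have hv0 : ∀ i, 1 ≤ i → i ≤ W + 1 → v i ≠ 0 := by
    intro i hi
    induction i, hi using Nat.le_induction with
    | base => exact fun _ => hy0
    | succ i hi ih =>
      intro hiW
      rcases Nat.lt_or_ge i 2 with h | h
      · rw [show i = 1 by omega]; exact hv2
      · intro h0
        rw [hv, ladder_succ y z hi] at h0
        exact hzC i h (by omega)
          ((hL.mem_twoStepCentralizer h (hvmem i hi) (ih (by omega)) hz1).2 h0)
  have hex : ∀ i, ∃ b : F, 1 ≤ i → v (i + 1) ≠ 0 → ⁅v i, y⁆ = b • v (i + 1) := fun i => by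
    by_cases h : 1 ≤ i ∧ v (i + 1) ≠ 0
    · obtain ⟨b, hb⟩ := hL.exists_eq_smul (by omega) (hvmem (i + 1) (by omega)) h.2
        (bracket_mem_succ (hvmem i h.1) hy.1)
      exact ⟨b, fun _ _ => hb⟩
    · exact ⟨0, fun h3 h4 => absurd ⟨h3, h4⟩ h⟩
  choose β hβ' using hex
  have hβ : ∀ i, 1 ≤ i → i ≤ W → ⁅v i, y⁆ = β i • v (i + 1) := fun i h3 h4 =>
    hβ' i h3 (hv0 _ (by omega) (by omega))
  refine ⟨β, ?_, fun i hi hiW => ?_, fun i hi hiW => ?_, ⟨fun i j hi hj hij => ?_,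
    fun i j hi hj hij => ?_⟩, fun i j hi hj hij h3 h4 h5 => ?_⟩
  · have h3 := hβ' 1 le_rfl hv2
    rw [show v 1 = y from rfl, lie_self] at h3
    exact (smul_eq_zero.1 h3.symm).resolve_right hv2
  · rw [← hyC i hi, hL.mem_twoStepCentralizer hi (hvmem i (by omega)) (hv0 i (by omega) (by omega))
      hy.1, hβ i (by omega) hiW, smul_eq_zero, or_iff_left (hv0 _ (by omega) (by omega))]
  · have h3 : ⁅v i, x⁆ = (1 - β i) • v (i + 1) := by
      rw [sub_smul, one_smul, ← hβ i (by omega) hiW, hv, ladder_succ y z (by omega), ← lie_sub,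
        hz, add_sub_cancel_right]
    rw [← hxC i hi, hL.mem_twoStepCentralizer hi (hvmem i (by omega)) (hv0 i (by omega) (by omega))
      hx.1, h3, smul_eq_zero, or_iff_left (hv0 _ (by omega) (by omega)), sub_eq_zero, eq_comm]
  · have h3 := lie_ladder hβ hj i hi hij
    have h4 := lie_ladder hβ hi j hj (by omega)
    rw [← lie_skew, h4, add_comm j i, ← neg_smul] at h3
    exact (smul_left_injective F (hv0 (i + j) (by omega) hij) h3).symm
  · have h3 := lie_lie_ladder hβ hi hj (by omega)
    rw [hβ (i + j) (by omega) hij, lie_ladder hβ hj (i + 1) (by omega) (by omega),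
      lie_ladder hβ (by omega) i hi (by omega), show i + 1 + j = i + j + 1 by ring,
      show i + (j + 1) = i + j + 1 by ring, smul_smul, smul_smul, smul_smul, ← add_smul] at h3
    exact smul_left_injective F (hv0 (i + j + 1) (by omega) (by omega)) h3
  -- In degree W + 1 nothing is known about z, but Jacobi with β_i = β_j = 0 still shows that `y`
  -- kills a nonzero multiple of v_{W+1}, which is itself nonzero.
  · have h6 := lie_lie_ladder hβ hi hj hij.le
    rw [h3, h4, zero_smul, zero_smul, add_zero, hij] at h6
    rw [← hyC _ (by omega), hL.mem_twoStepCentralizer (by omega) (hvmem _ (by omega))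
      (hv0 _ (by omega) le_rfl) hy.1]
    exact (smul_eq_zero.1 h6).resolve_left h5

theorem consecutiveConstituents_replicate_append {q l : ℕ} (m : ℕ) {i : ℕ}
    (h : ConsecutiveConstituents 𝓛 i (List.replicate m q ++ [l])) :
    (∀ t < m, IsConstituent 𝓛 (i + t * q) q) ∧ IsConstituent 𝓛 (i + m * q) l := by
  induction m generalizing i with
  | zero =>
    refine ⟨by simp, ?_⟩
    simpa using h.1
  | succ m ih =>
    rw [List.replicate_succ, List.cons_append] at h
    obtain ⟨h1, h2⟩ := ih h.2
    refine ⟨fun t ht => ?_, ?_⟩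
    · rcases t with _ | t
      · simpa using h.1
      · rw [show i + (t + 1) * q = i + q + t * q by ring]
        exact h1 t (by omega)
    · rw [show i + (m + 1) * q = i + q + m * q by ring]
      exact h2

end Lie

end MaximalClass

/-! ### Constituent lengths as an initial pattern -/

open MaximalClass in
/-- The constituents of lengths `2q, q, …, q` (with `m` short ones) comprise `C_2, …, C_{2q+mq}`,
so `hfirst` says that only the first two two-step centralizers `C_2` and `C_{2q}` occur before
the second non-short constituent; `hβ` says that the latter is intermediate, of length strictly
between `q` and `2q`. -/
theorem mainTheorem7 {F L : Type*} [Field F] [LieRing L] [LieAlgebra F L]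
    (p : ℕ) (hp : p.Prime) (hodd : Odd p) [CharP F p]
    (𝓛 : ℕ → Submodule F L) [GradedLieAlgebra 𝓛] (hL : MaximalClass.IsMaximalClass 𝓛)
    (hinf : ¬ FiniteDimensional F L)
    (q m β : ℕ) (hβ : p ^ β < q)
    (hlen : MaximalClass.ConstituentLengthsBegin 𝓛
      (2 * q :: (List.replicate m q ++ [2 * q - p ^ β])))
    (hfirst : ∀ i : ℕ, 2 ≤ i → i ≤ 2 * q + m * q →
      MaximalClass.twoStepCentralizer 𝓛 i = MaximalClass.twoStepCentralizer 𝓛 2 ∨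
      MaximalClass.twoStepCentralizer 𝓛 i = MaximalClass.twoStepCentralizer 𝓛 (2 * q)) :
    ∃ k : ℕ, m + 2 = p ^ k := by
  obtain ⟨⟨-, hne, hinit⟩, hcons⟩ := hlen
  obtain ⟨hshort, hlast⟩ := consecutiveConstituents_replicate_append m hcons
  have hpos : 0 < p ^ β := pow_pos hp.pos β
  have h2 : (2 : F) ≠ 0 := two_ne_zero_of_odd_prime hp hodd
  have H := hL.hasCoeffSequences hinf h2 (s := 2 * q) (by omega) hne
  have hmq : (m + 2 + 1) * q = 2 * q + m * q + q := by ring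
  -- The last constituent ends in degree 2q + mq + 2q - p^β = (r + 1)q + d with r = m + 2 and d = q
  -- - p^β; d is even, both powers of p being odd.
  have hpat : InitialPattern (fun i => twoStepCentralizer 𝓛 i = twoStepCentralizer 𝓛 2)
      (fun i => twoStepCentralizer 𝓛 i = twoStepCentralizer 𝓛 (2 * q)) q (m + 2) (q - p ^ β) 0 := by
    refine ⟨fun h h3 h4 => ?_, by simp, fun l h3 h4 h5 _ => ?_⟩
    · have h6 : h * q = 2 * q + (h - 2) * q := by rw [← add_mul]; congr 1; omega
      have h7 : (h - 2) * q ≤ m * q := Nat.mul_le_mul_right q (by omega)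
      rw [h6]
      refine (hfirst _ (by omega) (by omega)).resolve_left ?_
      rcases Nat.lt_or_ge (h - 2) m with h8 | h8
      · exact (hshort _ h8).2.2.1
      · rw [show h - 2 = m by omega]
        exact hlast.2.2.1
    · rcases Nat.lt_or_ge l (2 * q) with h6 | h6
      · exact hinit l h3 h6
      · have hdiv := Nat.div_add_mod l q
        have hmod := Nat.mod_lt l (show 0 < q by omega)
        have h2le : 2 ≤ l / q := (Nat.le_div_iff_mul_le (by omega)).2 h6
        rw [mul_comm] at hdiv
        have h7 : l / q * q = 2 * q + (l / q - 2) * q := by rw [← add_mul]; congr 1; omega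
        rcases Nat.lt_or_ge (l / q - 2) m with h8 | h8
        · have h9 : l % q ≠ 0 := fun h9 => h5 (l / q) h2le (by omega) (by omega)
          exact (hshort _ h8).2.2.2.2 l (by omega) (by omega)
        · have h9 : m * q ≤ (l / q - 2) * q := Nat.mul_le_mul_right q h8
          have h10 : l ≠ (m + 2) * q := h5 (m + 2) (by omega) le_rfl
          rw [add_mul] at h10
          exact hlast.2.2.2.2 l (by omega) (by omega)
  have hlastne : ¬ twoStepCentralizer 𝓛 ((m + 2 + 1) * q + (q - p ^ β))
      = twoStepCentralizer 𝓛 2 := by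
    have := hlast.2.2.2.1
    rwa [show 2 * q + m * q + (2 * q - p ^ β) = (m + 2 + 1) * q + (q - p ^ β) by omega] at this
  obtain ⟨k, hk⟩ := H.eq_prime_pow hp hodd (q := q) (by omega) (fun i h3 h4 h5 => by
    refine hpat.rest i h3 (by omega) (fun h h6 _ h7 => ?_) (by simp)
    rcases Nat.lt_or_ge h 3 with h8 | h8
    · exact h5 (by rw [h7]; congr 1; omega)
    · have := Nat.mul_le_mul_right q h8
      omega) rfl
  have hqo : Odd q := hk ▸ hodd.pow
  exact hpat.eq_prime_pow hp hodd hk (by omega) H (by omega) (by omega)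
    (Nat.Odd.sub_odd hqo hodd.pow) (by omega) hlastne
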